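/- For a partial computable function $\Phi$ from finite strings of natural numbers to $\{0,1\}\times\omega$ and a partial function $g$ from $\omega$ to $\omega$, the sequential computation $\Phi[g](n)$ proceeds in rounds. In round $s$, with responses $a_0,\dots,a_{s-1}$ obtained so far, evaluate $\Phi(n,a_0,\dots,a_{s-1})$; if it is $\langle 1,q\rangle$, the computation halts with output $q$; if it is $\langle 0,q\rangle$ and $q\in\mathrm{dom}(g)$, the computation continues with $a_s=g(q)$; if $\Phi(n,a_0,\dots,a_{s-1})$ is undefined or $q\notin\mathrm{dom}(g)$, then $\Phi[g](n)$ is undefined. For partial functions $f,g$ from $\omega$ to $\omega$, write $f\le_{\mathrm{subT}} g$ if there is a partial computable $\Phi$ such that $\Phi[g](n)$ is defined and equal to $f(n)$ for every $n\in\mathrm{dom}(f)$. The subTuring degrees are the equivalence classes of partial functions from $\omega$ to $\omega$ under mutual subTuring reducibility. They form a lattice, whose join is induced by $(f\oplus g)(2n)=f(n)$, $(f\oplus g)(2n+1)=g(n)$, and whose meet is induced by the partial function $f\cap g$ for which $(f\cap g)(d,e,n)$ is the common value of $\Phi_d[f](n)$ and $\Phi_e[g](n)$ if both are defined and equal, and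 is undefined otherwise; here $(\Phi_e)_{e\in\omega}$ is a standard numbering of the partial computable functions as above, and triples are coded by natural numbers. **Theorem.** The lattice of subTuring degrees is not distributive: the identity $a\vee(b\wedge c)=(a\vee b)\wedge(a\vee c)$ does not hold for all subTuring degrees $a,b,c$. In fact, there are partial functions $f,g,h$ from $\omega$ to $\omega$ such that $$(f\oplus g)\cap(f\oplus h)\not\le_{\mathrm{subT}} f\oplus(g\cap h).$$ -/

import Mathlib

namespace SubTuring

/-! ### Sequential computation relative to a partial oracle

Partial functions on the natural numbers are elements of `ℕ →. ℕ`.  The pair `(true, q)` stands for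
`⟨1, q⟩` (halt with output `q`) and `(false, q)` for `⟨0, q⟩` (ask the oracle for its value at `q`).
-/

/-- One round of the `g`-relative sequential computation by `Φ`.  The state is the list
`[n, a₀, …, aₛ₋₁]` of the input and of the oracle's responses so far.  The round ends with an output
(`Sum.inl`) or with the state of the next round (`Sum.inr`); it never ends if `Φ` diverges on the
state or if the query lies outside the domain of `g`. -/
def step (Φ : List ℕ →. Bool × ℕ) (g : ℕ →. ℕ) : List ℕ →. ℕ ⊕ List ℕ := fun l =>
  (Φ l).bind fun p =>
    match p with
    | (true, q) => Part.some (Sum.inl q)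
    | (false, q) => (g q).map fun a => Sum.inr (l ++ [a])

/-- The `g`-relative sequential computation `Φ[g]`: iterate the rounds, starting with the input
`n` and no responses, until a round yields an output. -/
def relComp (Φ : List ℕ →. Bool × ℕ) (g : ℕ →. ℕ) : ℕ →. ℕ := fun n =>
  PFun.fix (step Φ g) [n]

/-- `f` is subTuring reducible to `g`: there is a partial computable `Φ` such that `Φ[g]`
extends `f`. -/
def Reducible (f g : ℕ →. ℕ) : Prop :=
  ∃ Φ : List ℕ →. Bool × ℕ, Partrec Φ ∧ ∀ n v, v ∈ f n → v ∈ relComp Φ g n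

/-- The `e`-th partial computable function `Φₑ : ω^{<ω} ⇀ 2 × ω`, through the standard numbering
of the codes of partial recursive functions and the standard codings of lists and pairs. -/
def index (e : ℕ) : List ℕ →. Bool × ℕ := fun l =>
  ((Denumerable.ofNat Nat.Partrec.Code e).eval (Encodable.encode l)).bind fun m =>
    (Encodable.decode (α := Bool × ℕ) m : Part (Bool × ℕ))

/-- The join `f ⊕ g`: `(f ⊕ g)(2n) = f(n)` and `(f ⊕ g)(2n+1) = g(n)`. -/
def join (f g : ℕ →. ℕ) : ℕ →. ℕ := fun n =>
  if n % 2 = 0 then f (n / 2) else g (n / 2)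

/-- The meet `f ∩ g`: on (the code of) a triple `(d, e, n)` it is the common value of `Φ_d[f](n)`
and `Φ_e[g](n)` if both are defined and equal, and it is undefined otherwise. -/
def meet (f g : ℕ →. ℕ) : ℕ →. ℕ := fun m =>
  let d := m.unpair.1
  let e := m.unpair.2.unpair.1
  let n := m.unpair.2.unpair.2
  (relComp (index d) f n).bind fun v =>
    (relComp (index e) g n).bind fun w =>
      Part.assert (v = w) fun _ => Part.some v

/-! ### The reducibility is a preorder with binary joins and meets -/

theorem inl_mem_step {Φ : List ℕ →. Bool × ℕ} {g : ℕ →. ℕ} {l : List ℕ} {v : ℕ} :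
    Sum.inl v ∈ step Φ g l ↔ (true, v) ∈ Φ l := by
  unfold step
  simp only [Part.mem_bind_iff]
  constructor
  · rintro ⟨⟨b, q⟩, h, h'⟩
    cases b
    · simp at h'
    · simp only [Part.mem_some_iff, Sum.inl.injEq] at h'
      rwa [h']
  · intro h
    exact ⟨_, h, by simp⟩

theorem inr_mem_step {Φ : List ℕ →. Bool × ℕ} {g : ℕ →. ℕ} {l l' : List ℕ} :
    Sum.inr l' ∈ step Φ g l ↔ ∃ q a, (false, q) ∈ Φ l ∧ a ∈ g q ∧ l' = l ++ [a] := by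
  unfold step
  simp only [Part.mem_bind_iff]
  constructor
  · rintro ⟨⟨b, q⟩, h, h'⟩
    cases b
    · simp only [Part.mem_map_iff, Sum.inr.injEq] at h'
      obtain ⟨a, ha, e⟩ := h'
      exact ⟨q, a, h, ha, e.symm⟩
    · simp at h'
  · rintro ⟨q, a, h, ha, e⟩
    exact ⟨_, h, by simpa using ⟨a, ha, e.symm⟩⟩

theorem mem_fix_step {Φ : List ℕ →. Bool × ℕ} {g : ℕ →. ℕ} {l : List ℕ} {v : ℕ} :
    v ∈ PFun.fix (step Φ g) l ↔
      (true, v) ∈ Φ l ∨ ∃ q a, (false, q) ∈ Φ l ∧ a ∈ g q ∧ v ∈ PFun.fix (step Φ g) (l ++ [a]) := by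
  rw [PFun.mem_fix_iff, inl_mem_step]
  simp only [inr_mem_step]
  constructor
  · rintro (h | ⟨_, ⟨q, a, h, ha, rfl⟩, hv⟩)
    · exact Or.inl h
    · exact Or.inr ⟨q, a, h, ha, hv⟩
  · rintro (h | ⟨q, a, h, ha, hv⟩)
    · exact Or.inl h
    · exact Or.inr ⟨_, ⟨q, a, h, ha, rfl⟩, hv⟩

@[elab_as_elim]
theorem fix_step_induction {Φ : List ℕ →. Bool × ℕ} {g : ℕ →. ℕ} {v : ℕ} {C : List ℕ → Prop}
    {l : List ℕ} (h : v ∈ PFun.fix (step Φ g) l)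
    (base : ∀ l, (true, v) ∈ Φ l → C l)
    (ind : ∀ l q a, (false, q) ∈ Φ l → a ∈ g q → C (l ++ [a]) → C l) : C l := by
  refine PFun.fixInduction' h (fun l hl => base l (inl_mem_step.1 hl)) fun l l' _ hl ih => ?_
  obtain ⟨q, a, h, ha, rfl⟩ := inr_mem_step.1 hl
  exact ind l q a h ha ih

theorem partrec_index :
    Partrec fun p : ℕ × List ℕ => index p.1 p.2 := by
  unfold index
  refine Partrec.bind (f := fun p : ℕ × List ℕ =>
    (Denumerable.ofNat Nat.Partrec.Code p.1).eval (Encodable.encode p.2)) ?_ ?_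
  · exact Nat.Partrec.Code.eval_part.comp ((Computable.ofNat _).comp Computable.fst)
      (Computable.encode.comp Computable.snd)
  · exact (Computable.ofOption Computable.decode).comp Computable.snd

/-- The functions `index e` are exactly the partial computable ones. -/
theorem partrec_iff_exists_index {Φ : List ℕ →. Bool × ℕ} : Partrec Φ ↔ ∃ e, Φ = index e := by
  constructor
  · intro h
    obtain ⟨c, hc⟩ := Nat.Partrec.Code.exists_code.1 h
    refine ⟨Encodable.encode c, ?_⟩
    funext l
    simp only [index, Denumerable.ofNat_encode, hc, Encodable.encodek, Part.coe_some,
      Part.bind_some, Part.bind_map, Part.bind_some_right]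
  · rintro ⟨e, rfl⟩
    exact partrec_index.comp ((Computable.const e).pair Computable.id)

theorem Reducible.exists_index {f g : ℕ →. ℕ} (h : Reducible f g) :
    ∃ e, ∀ n v, v ∈ f n → v ∈ relComp (index e) g n := by
  obtain ⟨Φ, hΦ, h⟩ := h
  obtain ⟨e, rfl⟩ := partrec_iff_exists_index.1 hΦ
  exact ⟨e, h⟩

theorem Reducible.of_query {f g : ℕ →. ℕ} {t : ℕ → ℕ} (ht : Computable t)
    (h : ∀ n v, v ∈ f n → v ∈ g (t n)) : Reducible f g := by
  refine ⟨fun l => Part.some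
    (Option.casesOn l[1]? (false, t l.headI) fun a => (true, a)), ?_, ?_⟩
  · refine Computable.partrec (f := fun l : List ℕ =>
      ((Option.casesOn l[1]? (false, t l.headI) fun a => (true, a)) : Bool × ℕ)) ?_
    refine Computable.option_casesOn
      (Computable.list_getElem?.comp Computable.id (Computable.const 1)) ?_ ?_
    · exact (Computable.const false).pair (ht.comp Primrec.list_headI.to_comp)
    · exact (Computable.const true).pair Computable.snd
  · intro n v hv
    refine mem_fix_step.2 (Or.inr ⟨t n, v, by simp, h n v hv, ?_⟩)
    exact mem_fix_step.2 (Or.inl (by simp))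

theorem Reducible.refl (f : ℕ →. ℕ) : Reducible f f :=
  Reducible.of_query (t := id) Computable.id fun _ _ h => h

/-- Reduction by an index and an input which are computed from the given input. -/
theorem Reducible.of_uniform {f g : ℕ →. ℕ} {u t : ℕ → ℕ} (hu : Computable u) (ht : Computable t)
    (h : ∀ n v, v ∈ f n → v ∈ relComp (index (u n)) g (t n)) : Reducible f g := by
  refine ⟨fun l => index (u l.headI) (t l.headI :: l.tail), ?_, ?_⟩
  · exact partrec_index.comp ((hu.comp Primrec.list_headI.to_comp).pair
      (Computable.list_cons.comp (ht.comp Primrec.list_headI.to_comp) Primrec.list_tail.to_comp))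
  · intro n v hv
    suffices H : ∀ l : List ℕ, v ∈ PFun.fix (step (index (u n)) g) l →
        ∀ as, l = t n :: as →
        v ∈ PFun.fix (step (fun l => index (u l.headI) (t l.headI :: l.tail)) g) (n :: as) from
      H _ (h n v hv) [] rfl
    intro l hl
    refine fix_step_induction hl ?_ ?_
    · rintro _ hv as rfl
      exact mem_fix_step.2 (Or.inl hv)
    · rintro _ q a hq ha ih as rfl
      exact mem_fix_step.2 (Or.inr ⟨q, a, hq, ha, ih (as ++ [a]) rfl⟩)

/-- A step of the simulation of `Φ[Ψ[h]]`.  The state consists of the current state of `Φ`, the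
current state of `Ψ` (empty if `Ψ` is not running) and the responses of `h` not yet used. -/
def simStep (Φ Ψ : List ℕ →. Bool × ℕ) :
    List ℕ × List ℕ × List ℕ →. (Bool × ℕ) ⊕ (List ℕ × List ℕ × List ℕ) := fun s =>
  bif s.2.1.isEmpty then
    (Φ s.1).map fun p =>
      bif p.1 then Sum.inl (true, p.2) else Sum.inr (s.1, [p.2], s.2.2)
  else
    (Ψ s.2.1).map fun p =>
      bif p.1 then Sum.inr (s.1 ++ [p.2], [], s.2.2)
      else Option.casesOn s.2.2.head? (Sum.inl (false, p.2)) fun a =>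
        Sum.inr (s.1, s.2.1 ++ [a], s.2.2.tail)

theorem partrec_simStep {Φ Ψ : List ℕ →. Bool × ℕ} (hΦ : Partrec Φ) (hΨ : Partrec Ψ) :
    Partrec (simStep Φ Ψ) := by
  have h1 : Computable fun s : List ℕ × List ℕ × List ℕ => s.1 := Computable.fst
  have h2 : Computable fun s : List ℕ × List ℕ × List ℕ => s.2.1 :=
    Computable.fst.comp Computable.snd
  have h3 : Computable fun s : List ℕ × List ℕ × List ℕ => s.2.2 :=
    Computable.snd.comp Computable.snd
  have hE : Computable (List.isEmpty : List ℕ → Bool) := by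
    refine (Primrec.list_casesOn (f := fun l : List ℕ => l) (g := fun _ => true)
      (h := fun _ _ => false) Primrec.id (Primrec.const _) (Primrec.const _).to₂).to_comp.of_eq ?_
    intro l
    cases l <;> rfl
  have q1 : Computable fun x : (List ℕ × List ℕ × List ℕ) × Bool × ℕ => x.2.1 :=
    Computable.fst.comp Computable.snd
  have q2 : Computable fun x : (List ℕ × List ℕ × List ℕ) × Bool × ℕ => x.2.2 :=
    Computable.snd.comp Computable.snd
  refine Partrec.cond (hE.comp h2) ((hΦ.comp h1).map ?_) ((hΨ.comp h2).map ?_)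
  · refine Computable.cond q1 (Computable.sumInl.comp ((Computable.const true).pair q2))
      (Computable.sumInr.comp ?_)
    exact (h1.comp Computable.fst).pair
      ((Computable.list_cons.comp q2 (Computable.const [])).pair (h3.comp Computable.fst))
  · refine Computable.cond q1 (Computable.sumInr.comp ?_) ?_
    · exact (Computable.list_concat.comp (h1.comp Computable.fst) q2).pair
        ((Computable.const []).pair (h3.comp Computable.fst))
    · refine Computable.option_casesOn
        (Primrec.list_head?.to_comp.comp (h3.comp Computable.fst))
        (Computable.sumInl.comp ((Computable.const false).pair q2)) (Computable.sumInr.comp ?_)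
      have f1 : Computable fun y : ((List ℕ × List ℕ × List ℕ) × Bool × ℕ) × ℕ => y.1.1 :=
        Computable.fst.comp Computable.fst
      exact (h1.comp f1).pair ((Computable.list_concat.comp (h2.comp f1) Computable.snd).pair
        (Primrec.list_tail.to_comp.comp (h3.comp f1)))

theorem Reducible.trans {f g h : ℕ →. ℕ} (hfg : Reducible f g) (hgh : Reducible g h) :
    Reducible f h := by
  obtain ⟨Φ, hΦ, hf⟩ := hfg
  obtain ⟨Ψ, hΨ, hg⟩ := hgh
  let S := PFun.fix (simStep Φ Ψ)
  let Θ : List ℕ →. Bool × ℕ := fun l => S ([l.headI], [], l.tail)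
  refine ⟨Θ, ?_, ?_⟩
  · exact (partrec_simStep hΦ hΨ).fix.comp
      ((Computable.list_cons.comp Primrec.list_headI.to_comp (Computable.const [])).pair
        ((Computable.const []).pair Primrec.list_tail.to_comp))
  -- the run of `Θ` on any extension of `L` passes through the state `(bs, cs, rest)`
  let I : List ℕ → List ℕ → List ℕ → Prop := fun L bs cs =>
    L ≠ [] ∧ ∀ xs, Θ (L ++ xs) = S (bs, cs, xs)
  have query : ∀ {v : ℕ} {cs : List ℕ}, v ∈ PFun.fix (step Ψ h) cs → ∀ L bs, cs ≠ [] → I L bs cs →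
      ∃ L', I L' (bs ++ [v]) [] ∧
        ∀ w, w ∈ PFun.fix (step Θ h) L' → w ∈ PFun.fix (step Θ h) L := by
    intro v cs hv
    refine fix_step_induction hv ?_ ?_
    · rintro cs hv L bs hcs ⟨hL, hI⟩
      refine ⟨L, ⟨hL, fun xs => ?_⟩, fun _ hw => hw⟩
      rw [hI]
      refine PFun.fix_fwd_eq ?_
      cases cs with
      | nil => exact absurd rfl hcs
      | cons c cs => exact Part.mem_map_iff _ |>.2 ⟨_, hv, rfl⟩
    · rintro cs q a hq ha ih L bs hcs ⟨hL, hI⟩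
      obtain ⟨L', hI', hL'⟩ := ih (L ++ [a]) bs (by simp) ⟨by simp, fun xs => by
        rw [List.append_assoc, hI]
        refine PFun.fix_fwd_eq ?_
        cases cs with
        | nil => exact absurd rfl hcs
        | cons c cs => exact Part.mem_map_iff _ |>.2 ⟨_, hq, rfl⟩⟩
      refine ⟨L', hI', fun w hw => mem_fix_step.2 (Or.inr ⟨q, a, ?_, ha, hL' w hw⟩)⟩
      have := hI []
      rw [List.append_nil] at this
      rw [this]
      refine PFun.fix_stop ?_
      cases cs with
      | nil => exact absurd rfl hcs
      | cons c cs => exact Part.mem_map_iff _ |>.2 ⟨_, hq, rfl⟩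
  have main : ∀ {w : ℕ} {bs : List ℕ}, w ∈ PFun.fix (step Φ g) bs → ∀ L, I L bs [] →
      w ∈ PFun.fix (step Θ h) L := by
    intro w bs hw
    refine fix_step_induction hw ?_ ?_
    · rintro bs hw L ⟨hL, hI⟩
      refine mem_fix_step.2 (Or.inl ?_)
      have := hI []
      rw [List.append_nil] at this
      rw [this]
      exact PFun.fix_stop (Part.mem_map_iff _ |>.2 ⟨_, hw, rfl⟩)
    · rintro bs q a hq ha ih L ⟨hL, hI⟩
      obtain ⟨L', hI', hL'⟩ := query (hg q a ha) L bs (by simp) ⟨hL, fun xs => by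
        rw [hI]
        exact PFun.fix_fwd_eq (Part.mem_map_iff _ |>.2 ⟨_, hq, rfl⟩)⟩
      exact hL' w (ih L' hI')
  intro n v hv
  exact main (hf n v hv) [n] ⟨by simp, fun xs => rfl⟩

theorem reducible_join_left (f g : ℕ →. ℕ) : Reducible f (join f g) := by
  refine Reducible.of_query (t := fun n => 2 * n)
    (Primrec.nat_mul.comp (Primrec.const 2) Primrec.id).to_comp fun n v h => ?_
  simpa [join] using h

theorem reducible_join_right (f g : ℕ →. ℕ) : Reducible g (join f g) := by
  refine Reducible.of_query (t := fun n => 2 * n + 1)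
    (Primrec.succ.comp (Primrec.nat_mul.comp (Primrec.const 2) Primrec.id)).to_comp fun n v h => ?_
  have h1 : (2 * n + 1) % 2 ≠ 0 := by omega
  have h2 : (2 * n + 1) / 2 = n := by omega
  simpa [join, h1, h2] using h

theorem join_reducible {f g k : ℕ →. ℕ} (hf : Reducible f k) (hg : Reducible g k) :
    Reducible (join f g) k := by
  obtain ⟨d, hd⟩ := hf.exists_index
  obtain ⟨e, he⟩ := hg.exists_index
  refine Reducible.of_uniform (u := fun n => if n % 2 = 0 then d else e) (t := fun n => n / 2)
    ?_ ?_ fun n v h => ?_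
  · refine (Primrec.ite ?_ (Primrec.const d) (Primrec.const e)).to_comp
    exact Primrec.eq.comp (Primrec.nat_mod.comp Primrec.id (Primrec.const 2)) (Primrec.const 0)
  · exact (Primrec.nat_div.comp Primrec.id (Primrec.const 2)).to_comp
  · unfold join at h
    split_ifs at h ⊢ with hn
    · exact hd _ _ h
    · exact he _ _ h

theorem mem_meet {f g : ℕ →. ℕ} {m v : ℕ} :
    v ∈ meet f g m ↔ v ∈ relComp (index m.unpair.1) f m.unpair.2.unpair.2 ∧
      v ∈ relComp (index m.unpair.2.unpair.1) g m.unpair.2.unpair.2 := by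
  simp only [meet, Part.mem_bind_iff, Part.mem_assert_iff, Part.mem_some_iff]
  constructor
  · rintro ⟨v, hv, w, hw, rfl, rfl⟩
    exact ⟨hv, hw⟩
  · rintro ⟨hv, hw⟩
    exact ⟨v, hv, v, hw, rfl, rfl⟩

theorem meet_reducible_left (f g : ℕ →. ℕ) : Reducible (meet f g) f :=
  Reducible.of_uniform (u := fun m => m.unpair.1) (t := fun m => m.unpair.2.unpair.2)
    (Primrec.fst.comp Primrec.unpair).to_comp
    (Primrec.snd.comp (Primrec.unpair.comp (Primrec.snd.comp Primrec.unpair))).to_comp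
    fun _ _ h => (mem_meet.1 h).1

theorem meet_reducible_right (f g : ℕ →. ℕ) : Reducible (meet f g) g :=
  Reducible.of_uniform (u := fun m => m.unpair.2.unpair.1) (t := fun m => m.unpair.2.unpair.2)
    (Primrec.fst.comp (Primrec.unpair.comp (Primrec.snd.comp Primrec.unpair))).to_comp
    (Primrec.snd.comp (Primrec.unpair.comp (Primrec.snd.comp Primrec.unpair))).to_comp
    fun _ _ h => (mem_meet.1 h).2

theorem reducible_meet {f g k : ℕ →. ℕ} (hf : Reducible k f) (hg : Reducible k g) :
    Reducible k (meet f g) := by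
  obtain ⟨d, hd⟩ := hf.exists_index
  obtain ⟨e, he⟩ := hg.exists_index
  refine Reducible.of_query (t := fun n => Nat.pair d (Nat.pair e n)) ?_ fun n v h => ?_
  · exact (Primrec₂.natPair.comp (Primrec.const d)
      (Primrec₂.natPair.comp (Primrec.const e) Primrec.id)).to_comp
  · rw [mem_meet]
    simpa using ⟨hd n v h, he n v h⟩

instance : IsPreorder (ℕ →. ℕ) Reducible where
  refl := Reducible.refl
  trans _ _ _ := Reducible.trans

/-! ### The lattice of subTuring degrees -/

/-- SubTuring degrees: partial functions modulo mutual subTuring reducibility. -/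
def Degree : Type := Antisymmetrization (ℕ →. ℕ) Reducible

/-- The subTuring degree of a partial function. -/
def deg (f : ℕ →. ℕ) : Degree := toAntisymmetrization Reducible f

instance : LE Degree where
  le a b := Quotient.liftOn₂ a b Reducible fun _ _ _ _ h h' =>
    propext ⟨fun k => (h.2.trans k).trans h'.1, fun k => (h.1.trans k).trans h'.2⟩

theorem deg_le_deg {f g : ℕ →. ℕ} : deg f ≤ deg g ↔ Reducible f g := Iff.rfl

theorem deg_surjective : Function.Surjective deg := Quotient.exists_rep

/-- The degrees form a lattice, with the operations induced by `join` and `meet`. -/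
instance : Lattice Degree where
  le_refl a := by
    obtain ⟨f, rfl⟩ := deg_surjective a
    exact Reducible.refl f
  le_trans a b c := by
    obtain ⟨f, rfl⟩ := deg_surjective a
    obtain ⟨g, rfl⟩ := deg_surjective b
    obtain ⟨h, rfl⟩ := deg_surjective c
    exact Reducible.trans
  le_antisymm a b := by
    obtain ⟨f, rfl⟩ := deg_surjective a
    obtain ⟨g, rfl⟩ := deg_surjective b
    exact fun h h' => Quotient.sound ⟨h, h'⟩
  sup := Quotient.map₂ join fun _ _ h _ _ h' =>
    ⟨join_reducible (h.1.trans (reducible_join_left _ _)) (h'.1.trans (reducible_join_right _ _)),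
      join_reducible (h.2.trans (reducible_join_left _ _)) (h'.2.trans (reducible_join_right _ _))⟩
  inf := Quotient.map₂ meet fun _ _ h _ _ h' =>
    ⟨reducible_meet ((meet_reducible_left _ _).trans h.1) ((meet_reducible_right _ _).trans h'.1),
      reducible_meet ((meet_reducible_left _ _).trans h.2) ((meet_reducible_right _ _).trans h'.2)⟩
  le_sup_left a b := by
    obtain ⟨f, rfl⟩ := deg_surjective a
    obtain ⟨g, rfl⟩ := deg_surjective b
    exact reducible_join_left f g
  le_sup_right a b := by
    obtain ⟨f, rfl⟩ := deg_surjective a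
    obtain ⟨g, rfl⟩ := deg_surjective b
    exact reducible_join_right f g
  sup_le a b c := by
    obtain ⟨f, rfl⟩ := deg_surjective a
    obtain ⟨g, rfl⟩ := deg_surjective b
    obtain ⟨h, rfl⟩ := deg_surjective c
    exact join_reducible
  inf_le_left a b := by
    obtain ⟨f, rfl⟩ := deg_surjective a
    obtain ⟨g, rfl⟩ := deg_surjective b
    exact meet_reducible_left f g
  inf_le_right a b := by
    obtain ⟨f, rfl⟩ := deg_surjective a
    obtain ⟨g, rfl⟩ := deg_surjective b
    exact meet_reducible_right f g
  le_inf a b c := by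
    obtain ⟨f, rfl⟩ := deg_surjective a
    obtain ⟨g, rfl⟩ := deg_surjective b
    obtain ⟨h, rfl⟩ := deg_surjective c
    exact reducible_meet

theorem deg_sup (f g : ℕ →. ℕ) : deg f ⊔ deg g = deg (join f g) := rfl

theorem deg_inf (f g : ℕ →. ℕ) : deg f ⊓ deg g = deg (meet f g) := rfl

end SubTuring

/-! The functions are built generically by finite extensions. The function to be computed is `f ∘ g`
at those `n` where it agrees with `f ∘ h`: it is computed from `f ⊕ g` and from `f ⊕ h`, hence from
their meet.

The other side asks `f` or `g ∩ h`, and the latter answers only where a computation from `g` and one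
from `h` agree. If some extensions of the finite segments make these disagree, the query can be left
unanswered for good; if none do, the answer does not depend on the extension. A query to `f` at an
undecided point can also be left unanswered, as `g n` and `h n` can still be sent elsewhere. So a
run either gets stuck or receives answers fixed in advance, and then `f` can take at `g n` and `h n`
a value other than its output. This is `forceable_of_run`; `exists_forall_of_finite_extension`
treats all indices in turn. -/

namespace SubTuring

/-! ### Finite extensions and finite use -/

/-- Finite extension method: if every requirement can be forced by a finite extension of every
finite initial segment, then some sequence meets all the requirements. -/
theorem exists_forall_of_finite_extension {α : Type*} [Inhabited α] (W : ℕ → (ℕ → α) → Prop)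
    (hW : ∀ (k N : ℕ) (T : ℕ → α), ∃ (N' : ℕ) (T' : ℕ → α), (∀ i < N, T' i = T i) ∧
      ∀ T'' : ℕ → α, (∀ i < N', T'' i = T' i) → W k T'') :
    ∃ T, ∀ k, W k T := by
  choose M E hE hM using hW
  -- A stage is a length and a sequence final below it. The `p.1 + 1` makes stage `i + 1` longer
  -- than `i`, so its value at `i` is final.
  let s : ℕ → ℕ × (ℕ → α) := fun k =>
    Nat.rec (0, fun _ => default) (fun k p => (max (p.1 + 1) (M k p.1 p.2), E k p.1 p.2)) k
  have hs : ∀ k, s (k + 1) = (max ((s k).1 + 1) (M k (s k).1 (s k).2), E k (s k).1 (s k).2) :=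
    fun _ => rfl
  have hlt : ∀ k, (s k).1 < (s (k + 1)).1 := fun k => by
    rw [hs]
    exact lt_of_lt_of_le (Nat.lt_succ_self _) (le_max_left _ _)
  have hmono : StrictMono fun k => (s k).1 := strictMono_nat_of_lt_succ hlt
  have hagree : ∀ k j, k ≤ j → ∀ i < (s k).1, (s j).2 i = (s k).2 i := by
    intro k j hkj
    induction j, hkj using Nat.le_induction with
    | base => exact fun _ _ => rfl
    | succ j hkj ih =>
      intro i hi
      rw [← ih i hi, hs]
      exact hE _ _ _ _ (hi.trans_le (hmono.monotone hkj))
  refine ⟨fun i => (s (i + 1)).2 i, fun k => hM k (s k).1 (s k).2 _ fun i hi => ?_⟩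
  have hi' : i < (s (k + 1)).1 := by
    rw [hs]
    exact hi.trans_le (le_max_right _ _)
  have hE' : E k (s k).1 (s k).2 = (s (k + 1)).2 := by rw [hs]
  rw [hE']
  rcases le_total (i + 1) (k + 1) with h | h
  · exact (hagree _ _ h i ((Nat.lt_succ_self i).trans_le (hmono.le_apply))).symm
  · exact hagree _ _ h i hi'

/-- A converging computation depends on a finite part of the oracle only. -/
theorem exists_use {Φ : List ℕ →. Bool × ℕ} {g : ℕ →. ℕ} {l : List ℕ} {v : ℕ}
    (h : v ∈ PFun.fix (step Φ g) l) :
    ∃ M, ∀ g' : ℕ →. ℕ, (∀ i < M, g' i = g i) → v ∈ PFun.fix (step Φ g') l := by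
  refine fix_step_induction h ?_ ?_
  · exact fun l hl => ⟨0, fun _ _ => mem_fix_step.2 (Or.inl hl)⟩
  · rintro l q a hq ha ⟨M, hM⟩
    refine ⟨max M (q + 1), fun g' hg' => mem_fix_step.2 (Or.inr ⟨q, a, hq, ?_, ?_⟩)⟩
    · rwa [hg' q (lt_of_lt_of_le (Nat.lt_succ_self q) (le_max_right _ _))]
    · exact hM g' fun i hi => hg' i (hi.trans_le (le_max_left _ _))

theorem join_two_mul (f g : ℕ →. ℕ) (n : ℕ) : join f g (2 * n) = f n := by
  simp [join]

theorem join_two_mul_add_one (f g : ℕ →. ℕ) (n : ℕ) : join f g (2 * n + 1) = g n := by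
  have h2 : (2 * n + 1) / 2 = n := by omega
  simp [join, h2]

/-- A partial function can be redefined at a point without changing its values below. -/
theorem exists_mem_agree_below (k : ℕ →. ℕ) (n x : ℕ) :
    ∃ k' : ℕ →. ℕ, (∀ i < n, k' i = k i) ∧ x ∈ k' n :=
  ⟨fun i => if i < n then k i else Part.some x, fun _ hi => if_pos hi, by simp⟩

/-- Some index computes the composition `f ∘ g` from `f ⊕ g`. -/
theorem exists_index_comp : ∃ c, ∀ (f g : ℕ →. ℕ) (n x v : ℕ), x ∈ g n → v ∈ f x →
    v ∈ relComp (index c) (join f g) n := by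
  -- The entries `l[1]?` and `l[2]?` are the responses of `g` (odd query) and then of `f` (even
  -- query).
  let Φ : List ℕ → Bool × ℕ := fun l =>
    Option.casesOn l[1]? (false, 2 * l.headI + 1) fun a =>
      (Option.casesOn l[2]? (false, 2 * a) fun b => (true, b) : Bool × ℕ)
  have hdouble : Computable fun n : ℕ => 2 * n :=
    (Primrec.nat_mul.comp (Primrec.const 2) Primrec.id).to_comp
  have hΦ : Computable Φ := by
    refine Computable.option_casesOn
      (Computable.list_getElem?.comp Computable.id (Computable.const 1)) ?_ ?_
    · exact (Computable.const false).pair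
        (Computable.succ.comp (hdouble.comp Primrec.list_headI.to_comp))
    · refine Computable.option_casesOn
        (Computable.list_getElem?.comp Computable.fst (Computable.const 2)) ?_ ?_
      · exact (Computable.const false).pair (hdouble.comp Computable.snd)
      · exact (Computable.const true).pair Computable.snd
  obtain ⟨c, hc⟩ := partrec_iff_exists_index.1 hΦ.partrec
  refine ⟨c, fun f g n x v hx hv => ?_⟩
  rw [← hc]
  refine mem_fix_step.2 (Or.inr ⟨2 * n + 1, x, by simp [Φ], ?_, ?_⟩)
  · rwa [join_two_mul_add_one]
  refine mem_fix_step.2 (Or.inr ⟨2 * x, v, by simp [Φ], ?_, ?_⟩)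
  · rwa [join_two_mul]
  exact mem_fix_step.2 (Or.inl (by simp [Φ]))

/-! ### Forcing a disagreement -/

/-- The finite initial segment of length `N` of `(f', g', h')` extends the one of `(f, g, h)`, forces
that `f' ∘ g'` and `f' ∘ h'` have a common value at `n`, and forces that `Ψ` with the oracle
`f' ⊕ (g' ∩ h')` does not output this value when started in the state `l`. -/
def Forceable (Ψ : List ℕ →. Bool × ℕ) (f g h : ℕ →. ℕ) (n : ℕ) (l : List ℕ) : Prop :=
  ∃ (N : ℕ) (f' g' h' : ℕ →. ℕ) (x y v : ℕ),
    (∀ i < n, f' i = f i ∧ g' i = g i ∧ h' i = h i) ∧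
    n < N ∧ x < N ∧ y < N ∧ n ≤ x ∧ n ≤ y ∧ x ∈ g' n ∧ y ∈ h' n ∧ v ∈ f' x ∧ v ∈ f' y ∧
    ∀ f'' g'' h'' : ℕ →. ℕ, (∀ i < N, f'' i = f' i ∧ g'' i = g' i ∧ h'' i = h' i) →
      v ∉ PFun.fix (step Ψ (join f'' (meet g'' h''))) l

/-- Forcing with prescribed `g'` and `h'` and with a function `f'` which is constant from `n` on,
except for one point at most. -/
theorem Forceable.of_const {Ψ : List ℕ →. Bool × ℕ} {f g h : ℕ →. ℕ} {n : ℕ} {l : List ℕ}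
    (N : ℕ) (g' h' : ℕ →. ℕ) (x y v z : ℕ) (hgh : ∀ i < n, g' i = g i ∧ h' i = h i)
    (hx : n ≤ x) (hy : n ≤ y) (hxg : x ∈ g' n) (hyh : y ∈ h' n) (hxz : x ≠ z) (hyz : y ≠ z)
    (H : ∀ f'' g'' h'' : ℕ →. ℕ, (n ≤ z → f'' z = Part.none) →
      (∀ i < N, g'' i = g' i ∧ h'' i = h' i) →
      v ∉ PFun.fix (step Ψ (join f'' (meet g'' h''))) l) :
    Forceable Ψ f g h n l := by
  -- The length exceeds `x`, `y` and `z`, so the segment fixes both values of `f'` and its hole at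
  -- `z`.
  refine ⟨max N (n + x + y + z + 1),
    fun i => if i < n then f i else if i = z then Part.none else Part.some v,
    g', h', x, y, v, fun i hi => ⟨if_pos hi, hgh i hi⟩, ?_, ?_, ?_, hx, hy, hxg, hyh, ?_, ?_,
    fun f'' g'' h'' hf => H f'' g'' h'' (fun hz => ?_) fun i hi => ?_⟩
  · exact lt_of_lt_of_le (by omega) (le_max_right _ _)
  · exact lt_of_lt_of_le (by omega) (le_max_right _ _)
  · exact lt_of_lt_of_le (by omega) (le_max_right _ _)
  · simp [hx.not_gt, hxz]
  · simp [hy.not_gt, hyz]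
  · rw [(hf z (lt_of_lt_of_le (by omega) (le_max_right _ _))).1]
    simp [hz.not_gt]
  · exact (hf i (hi.trans_le (le_max_left _ _))).2

/-- Induction backwards along the given run: at each query, either some extension stops the
computation there, or the answer `a` of the given run is the only possible one and forcing passes
back from the next state. The oracles of the run need not agree with those produced; `n ≤ y₀` only
makes `h₀` admissible for comparison. -/
theorem forceable_of_run {Ψ : List ℕ →. Bool × ℕ} {f g h f₀ g₀ h₀ : ℕ →. ℕ} {n y₀ v₀ : ℕ}
    {l : List ℕ} (hl : v₀ ∈ PFun.fix (step Ψ (join f₀ (meet g₀ h₀))) l)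
    (hext : ∀ i < n, f₀ i = f i ∧ g₀ i = g i ∧ h₀ i = h i)
    (hy₀ : n ≤ y₀) (hyh₀ : y₀ ∈ h₀ n) :
    Forceable Ψ f g h n l := by
  refine fix_step_induction hl ?_ ?_
  · intro l hv
    obtain ⟨g', hg, hgn⟩ := exists_mem_agree_below g n (n + 1)
    obtain ⟨h', hh, hhn⟩ := exists_mem_agree_below h n (n + 1)
    -- The output is already `v₀`, so `v₀ + 1` is safe; the hole at `n` merely avoids `n + 1`.
    refine Forceable.of_const 0 _ _ (n + 1) (n + 1) (v₀ + 1) n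
      (fun i hi => ⟨hg i hi, hh i hi⟩) (by omega) (by omega)
      hgn hhn (by omega) (by omega) fun f'' g'' h'' _ _ hw => ?_
    rcases mem_fix_step.1 hw with hw | ⟨q, a, hq, -⟩
    · have := Part.mem_unique hv hw
      simp at this
    · have := Part.mem_unique hv hq
      simp at this
  · intro l q a hq ha ih
    -- a run from `l` has to pass through the query `q`
    have pass : ∀ {O : ℕ →. ℕ} {w : ℕ}, w ∈ PFun.fix (step Ψ O) l →
        ∃ b ∈ O q, w ∈ PFun.fix (step Ψ O) (l ++ [b]) := by
      intro O w hw
      rcases mem_fix_step.1 hw with hw | ⟨q', b, hq', hb, hw⟩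
      · have := Part.mem_unique hq hw
        simp at this
      · have := Part.mem_unique hq hq'
        simp only [Prod.mk.injEq, true_and] at this
        subst this
        exact ⟨b, hb, hw⟩
    rcases Nat.even_or_odd' q with ⟨z, rfl | rfl⟩
    · rw [join_two_mul] at ha
      rcases lt_or_ge z n with hz | hz
      · obtain ⟨N, f', g', h', x, y, v, hf, hn, hx, hy, hnx, hny, hxg, hyh, hvx, hvy, H⟩ := ih
        refine ⟨N, f', g', h', x, y, v, hf, hn, hx, hy, hnx, hny, hxg, hyh, hvx, hvy,
          fun f'' g'' h'' hf'' hw => ?_⟩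
        obtain ⟨b, hb, hw⟩ := pass hw
        rw [join_two_mul, (hf'' z (hz.trans hn)).1, (hf z hz).1, ← (hext z hz).1] at hb
        rw [Part.mem_unique hb ha] at hw
        exact H f'' g'' h'' hf'' hw
      -- The hole is put at the queried point `z`, and `g n`, `h n` are moved past it.
      · obtain ⟨g', hg, hgn⟩ := exists_mem_agree_below g n (z + 1)
        obtain ⟨h', hh, hhn⟩ := exists_mem_agree_below h n (z + 1)
        refine Forceable.of_const 0 _ _ (z + 1) (z + 1) 0 z
          (fun i hi => ⟨hg i hi, hh i hi⟩) (by omega) (by omega)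
          hgn hhn (by omega) (by omega) fun f'' g'' h'' hz' _ hw => ?_
        obtain ⟨b, hb, -⟩ := pass hw
        rw [join_two_mul, hz' hz] at hb
        exact Part.notMem_none _ hb
    · rw [join_two_mul_add_one] at ha
      -- Can the two computations behind the query be made to disagree?
      by_cases hc : ∃ (g' h' : ℕ →. ℕ) (x y v w : ℕ), (∀ i < n, g' i = g i ∧ h' i = h i) ∧
          n ≤ x ∧ n ≤ y ∧ x ∈ g' n ∧ y ∈ h' n ∧
          v ∈ relComp (index z.unpair.1) g' z.unpair.2.unpair.2 ∧
          w ∈ relComp (index z.unpair.2.unpair.1) h' z.unpair.2.unpair.2 ∧ v ≠ w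
      · obtain ⟨g', h', x, y, v, w, hgh, hx, hy, hxg, hyh, hv, hw, hne⟩ := hc
        obtain ⟨M, hM⟩ := exists_use hv
        obtain ⟨K, hK⟩ := exists_use hw
        -- Preserving both uses keeps the meet undefined at `z`; the hole `x + y + 1` just avoids
        -- `x` and `y`.
        refine Forceable.of_const (max M K) g' h' x y 0 (x + y + 1) hgh hx hy hxg hyh
          (by omega) (by omega) fun f'' g'' h'' _ hgh'' hu => ?_
        obtain ⟨b, hb, -⟩ := pass hu
        rw [join_two_mul_add_one, mem_meet] at hb
        refine hne ((Part.mem_unique ?_ hb.1).trans (Part.mem_unique hb.2 ?_))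
        · exact hM g'' fun i hi => (hgh'' i (hi.trans_le (le_max_left _ _))).1
        · exact hK h'' fun i hi => (hgh'' i (hi.trans_le (le_max_right _ _))).2
      · obtain ⟨N, f', g', h', x, y, v, hf, hn, hx, hy, hnx, hny, hxg, hyh, hvx, hvy, H⟩ := ih
        refine ⟨N, f', g', h', x, y, v, hf, hn, hx, hy, hnx, hny, hxg, hyh, hvx, hvy,
          fun f'' g'' h'' hf'' hw => ?_⟩
        obtain ⟨b, hb, hw⟩ := pass hw
        rw [join_two_mul_add_one, mem_meet] at hb
        -- Mixing the two extensions, `g''` gives `b` and `h₀` gives `a`; no disagreement is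
        -- possible.
        have hba : b = a := by
          by_contra hne
          refine hc ⟨g'', h₀, x, y₀, b, a, fun i hi => ⟨?_, (hext i hi).2.2⟩, hnx, hy₀, ?_, hyh₀,
            hb.1, (mem_meet.1 ha).2, hne⟩
          · rw [(hf'' i (hi.trans hn)).2.1, (hf i hi).2.1]
          · rwa [(hf'' n hn).2.1]
        rw [hba] at hw
        exact H f'' g'' h'' hf'' hw

/-- Set all three functions to `n` at `n`. Either this forces that `n` is not output, or a further
extension has a run to which `forceable_of_run` applies. -/
theorem forceable (Ψ : List ℕ →. Bool × ℕ) (f g h : ℕ →. ℕ) (n : ℕ) (l : List ℕ) :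
    Forceable Ψ f g h n l := by
  by_contra hnot
  obtain ⟨f', hf, hfn⟩ := exists_mem_agree_below f n n
  obtain ⟨g', hg, hgn⟩ := exists_mem_agree_below g n n
  obtain ⟨h', hh, hhn⟩ := exists_mem_agree_below h n n
  refine hnot ⟨n + 1, f', g', h', n, n, n, fun i hi => ⟨hf i hi, hg i hi, hh i hi⟩,
    by omega, by omega, by omega, le_rfl, le_rfl, hgn, hhn, hfn, hfn,
    fun f'' g'' h'' hf'' hv => hnot ?_⟩
  refine forceable_of_run hv (fun i hi => ?_) (le_refl n) ?_
  · obtain ⟨h1, h2, h3⟩ := hf'' i (by omega)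
    exact ⟨h1.trans (hf i hi), h2.trans (hg i hi), h3.trans (hh i hi)⟩
  · rwa [(hf'' n (by omega)).2.2]

/-! ### Construction of the three functions -/

/-- The distributive inequality fails for some partial functions. -/
theorem exists_not_reducible : ∃ f g h : ℕ →. ℕ,
    ¬ Reducible (meet (join f g) (join f h)) (join f (meet g h)) := by
  obtain ⟨c, hc⟩ := exists_index_comp
  let W : ℕ → (ℕ → Part ℕ × Part ℕ × Part ℕ) → Prop := fun e T =>
    let f : ℕ →. ℕ := fun i => (T i).1
    let g : ℕ →. ℕ := fun i => (T i).2.1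
    let h : ℕ →. ℕ := fun i => (T i).2.2
    ∃ n x y v, x ∈ g n ∧ y ∈ h n ∧ v ∈ f x ∧ v ∈ f y ∧
      v ∉ relComp (index e) (join f (meet g h)) (Nat.pair c (Nat.pair c n))
  obtain ⟨T, hT⟩ := exists_forall_of_finite_extension W fun e n T => by
    -- The length `n` of the decided segment serves as the diagonalization point, the first where
    -- `g` and `h` are free.
    obtain ⟨N, f', g', h', x, y, v, hf, hn, hx, hy, -, -, hxg, hyh, hvx, hvy, H⟩ :=
      forceable (index e) (fun i => (T i).1) (fun i => (T i).2.1) (fun i => (T i).2.2) n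
        [Nat.pair c (Nat.pair c n)]
    refine ⟨N, fun i => (f' i, g' i, h' i), fun i hi => ?_, fun T'' hT'' =>
      ⟨n, x, y, v, ?_, ?_, ?_, ?_, H _ _ _ fun i hi => ?_⟩⟩
    · obtain ⟨h1, h2, h3⟩ := hf i hi
      exact Prod.ext h1 (Prod.ext h2 h3)
    · simpa only [hT'' n hn] using hxg
    · simpa only [hT'' n hn] using hyh
    · simpa only [hT'' x hx] using hvx
    · simpa only [hT'' y hy] using hvy
    · simp only [hT'' i hi]
      exact ⟨trivial, trivial, trivial⟩
  refine ⟨fun i => (T i).1, fun i => (T i).2.1, fun i => (T i).2.2, fun hred => ?_⟩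
  obtain ⟨e, he⟩ := hred.exists_index
  obtain ⟨n, x, y, v, hx, hy, hvx, hvy, hnot⟩ := hT e
  refine hnot (he _ v (mem_meet.2 ?_))
  simpa using ⟨hc _ _ n x v hx hvx, hc _ _ n y v hy hvy⟩

end SubTuring

theorem mainTheorem3 :
    (¬ ∀ a b c : SubTuring.Degree, a ⊔ (b ⊓ c) = (a ⊔ b) ⊓ (a ⊔ c)) ∧
    ∃ f g h : ℕ →. ℕ,
      ¬ SubTuring.Reducible
          (SubTuring.meet (SubTuring.join f g) (SubTuring.join f h))
          (SubTuring.join f (SubTuring.meet g h)) := by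
  obtain ⟨f, g, h, hred⟩ := SubTuring.exists_not_reducible
  refine ⟨fun H => hred ?_, f, g, h, hred⟩
  exact SubTuring.deg_le_deg.1 (H (SubTuring.deg f) (SubTuring.deg g) (SubTuring.deg h)).ge
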